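/- For integers $m\ge 2$, $n,P\ge 1$, a single-track Gray code of length $n$ and period $P$ over $\mathbb{Z}_m$ is a cyclic list $W_0,\dots,W_{P-1}$ of $P$ distinct words of length $n$ over $\mathbb{Z}_m$ such that any two cyclically consecutive words (including the last and the first) differ in exactly one position, and such that each column of the $P\times n$ array with rows $W_0,\dots,W_{P-1}$ is a cyclic shift of its first column. Let $p$ be an odd prime and $t\ge 1$. Then there exists a single-track Gray code of length $p^t$ and period $p^{p^t}$ over $\mathbb{Z}_p$. Every such code contains each word of length $p^t$ over $\mathbb{Z}_p$ exactly once, and $p^{p^t}$ is the maximum possible period: every single-track Gray code of length $p^t$ over $\mathbb{Z}_p$ has period at most $p^{p^t}$. -/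

import Mathlib

/-- `W` is a single-track Gray code of length `n` and period `P` over the alphabet `ℤ_m`: a
cyclically indexed list of `P` words of length `n`. -/
structure IsSingleTrackGrayCode (m n P : ℕ) (W : ZMod P → Fin n → ZMod m) : Prop where
  /-- The period is positive, so that `ZMod P` has exactly `P` elements. -/
  period_pos : 0 < P
  /-- The `P` words are distinct. -/
  distinct : Function.Injective W
  /-- Cyclically consecutive words differ in exactly one position. -/
  gray : ∀ j : ZMod P, ∃! i : Fin n, W j i ≠ W (j + 1) i
  /-- Every column of the `P × n` array is a cyclic shift of the first column. -/
  single_track : ∀ i : Fin n, ∃ k : ZMod P, ∀ j : ZMod P, W j i = W (j + k) ⟨0, i.pos⟩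

/-!
Put `n = p ^ t`, so that `X ^ n - 1 = (X - 1) ^ n` over `ZMod p`. The word with generating
polynomial `g` modulo `X ^ n - 1` is coded by `a = 1 + (X - 1) * g` modulo `(X - 1) ^ (n + 1)`.
Multiplying `a` by `X` shifts the word cyclically and adds `1` to its first letter; this has order
`p ^ (t + 1)` and all its orbits have that size. Changing the letter at position `i` by `c` adds
`c * (X - 1) * X ^ i` to `a`.

Suppose a path of such one-letter changes visits every shift orbit once and ends at its starting
point multiplied by `X ^ b`, with `b` prime to `p`. Following its images under `X ^ b`, `X ^ (2b)`,
… gives a cyclic list of all words. Moving along this list by a multiple of the length of the path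
realises any power of `X`, so column `i`, which is column `0` of the list multiplied by `X ^ (-i)`,
is a shift of column `0`.

The path is built modulo `(X - 1) ^ J` by induction on `J`. When `J` is a power of `p`, the orbit
size is multiplied by `p` on passing to `J + 1`, the number of orbits does not change, and the same
path works. Otherwise every orbit splits into `p` orbits, which are told apart by the coefficient of
`(X - 1) ^ J`. If the closing defect of the path has multiplicity exactly `J` at `X = 1`, then going
around the path `p` times adds this defect again and again and meets each of the `p` orbits once. A
single step that can be replaced by another one into the same orbit serves to adjust the defect.
-/

open Polynomial Function

section Code

variable {m n P : ℕ}

theorem IsSingleTrackGrayCode.period_le [NeZero m] {W : ZMod P → Fin n → ZMod m}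
    (hW : IsSingleTrackGrayCode m n P W) : P ≤ m ^ n := by
  have : NeZero P := ⟨hW.period_pos.ne'⟩
  simpa [ZMod.card] using Fintype.card_le_of_injective W hW.distinct

theorem IsSingleTrackGrayCode.existsUnique_eq {W : ZMod (m ^ n) → Fin n → ZMod m}
    [NeZero m] (hW : IsSingleTrackGrayCode m n (m ^ n) W) (w : Fin n → ZMod m) :
    ∃! j, W j = w :=
  have hbij : Bijective W :=
    (Fintype.bijective_iff_injective_and_card W).2 ⟨hW.distinct, by simp [ZMod.card]⟩
  hbij.existsUnique w

theorem isSingleTrackGrayCode_of_periodic {F : ℕ → Fin n → ZMod m} (hP : 0 < P)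
    (hper : Periodic F P) (hinj : Set.InjOn F (Set.Iio P))
    (hgray : ∀ k, ∃! i, F k i ≠ F (k + 1) i)
    (htrack : ∀ i : Fin n, ∃ s, ∀ k, F (k + s) i = F k ⟨0, i.pos⟩) :
    IsSingleTrackGrayCode m n P fun j => F j.val := by
  have : NeZero P := ⟨hP.ne'⟩
  have hcast (k : ℕ) : F (k : ZMod P).val = F k := by
    rw [ZMod.val_natCast]
    exact hper.map_mod_nat k
  refine ⟨hP, fun j l hjl => ?distinct, fun j => ?gray, fun i => ?track⟩
  case distinct => exact ZMod.val_injective P (hinj j.val_lt l.val_lt hjl)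
  case gray =>
    obtain ⟨k, rfl⟩ := ZMod.natCast_zmod_surjective j
    simpa only [← Nat.cast_succ, hcast] using hgray k
  case track =>
    obtain ⟨s, hs⟩ := htrack i
    refine ⟨-(s : ZMod P), fun j => ?_⟩
    obtain ⟨k, hk⟩ := ZMod.natCast_zmod_surjective (j + -(s : ZMod P))
    obtain rfl : j = (k + s : ℕ) := by rw [Nat.cast_add, hk]; ring
    rw [← hk, hcast, hcast, hs]

end Code

section PowersOfX

variable {R : Type*} [CommRing R]

theorem X_sub_one_dvd_iff {a : R[X]} : X - 1 ∣ a ↔ a.eval 1 = 0 := by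
  simpa using dvd_iff_isRoot (p := a) (a := (1 : R))

theorem X_sub_one_pow_dvd_X_pow_sub_one_mul {J : ℕ} {a : R[X]} (ha : (X - 1) ^ J ∣ a) (d : ℕ) :
    (X - 1) ^ (J + 1) ∣ (X ^ d - 1) * a := by
  rw [pow_succ']
  exact mul_dvd_mul (sub_one_dvd_pow_sub_one X d) ha

theorem prime_X_sub_one [IsDomain R] : Prime (X - 1 : R[X]) := by
  simpa using prime_X_sub_C (1 : R)

theorem X_sub_one_pow_dvd_mul_iff [IsDomain R] {J : ℕ} {a b : R[X]} (ha : a.eval 1 ≠ 0) :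
    (X - 1) ^ J ∣ a * b ↔ (X - 1) ^ J ∣ b :=
  ⟨prime_X_sub_one.pow_dvd_of_dvd_mul_left J (mt X_sub_one_dvd_iff.1 ha),
    fun h => h.mul_left a⟩

theorem emultiplicity_X_sub_one_pow_mul [IsDomain R] {J : ℕ} {a : R[X]} (ha : a.eval 1 ≠ 0) :
    emultiplicity (X - 1) ((X - 1) ^ J * a) = J := by
  rw [emultiplicity_mul prime_X_sub_one, emultiplicity_pow_self_of_prime prime_X_sub_one,
    emultiplicity_eq_zero.2 (mt X_sub_one_dvd_iff.1 ha), add_zero]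

variable (p : ℕ) [Fact p.Prime] [CharP R p]

theorem X_pow_prime_pow_sub_one (s : ℕ) : (X ^ p ^ s - 1 : R[X]) = (X - 1) ^ p ^ s := by
  rw [sub_pow_char_pow, one_pow]

variable [IsDomain R]

theorem X_sub_one_pow_dvd_X_pow_sub_one_iff {J c : ℕ} :
    (X - 1 : R[X]) ^ J ∣ X ^ c - 1 ↔ p ^ Nat.clog p J ∣ c := by
  have hp : p.Prime := Fact.out
  constructor
  · intro h
    rcases eq_or_ne c 0 with rfl | hc
    · exact dvd_zero _
    obtain ⟨v, m, hm, rfl⟩ := Nat.exists_eq_pow_mul_and_not_dvd hc p hp.ne_one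
    have hgeom : (X ^ (p ^ v * m) - 1 : R[X])
        = (∑ i ∈ Finset.range m, X ^ i) ^ p ^ v * (X - 1) ^ p ^ v := by
      rw [← mul_pow, geom_sum_mul, sub_pow_char_pow, one_pow, ← pow_mul, mul_comm]
    have heval : eval 1 ((∑ i ∈ Finset.range m, X ^ i : R[X]) ^ p ^ v) ≠ 0 := by
      simpa [eval_finsetSum, CharP.cast_eq_zero_iff R p] using fun h : p ∣ m => (hm h).elim
    rw [hgeom, X_sub_one_pow_dvd_mul_iff heval,
      pow_dvd_pow_iff prime_X_sub_one.ne_zero prime_X_sub_one.not_isUnit] at h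
    exact (pow_dvd_pow p (Nat.clog_le_of_le_pow h)).mul_right m
  · rintro ⟨m, rfl⟩
    calc (X - 1 : R[X]) ^ J ∣ (X - 1) ^ p ^ Nat.clog p J :=
          pow_dvd_pow _ (Nat.le_pow_clog hp.one_lt J)
      _ = X ^ p ^ Nat.clog p J - 1 := (X_pow_prime_pow_sub_one p _).symm
      _ ∣ X ^ (p ^ Nat.clog p J * m) - 1 := by
          rw [pow_mul]
          exact sub_one_dvd_pow_sub_one _ m

theorem X_sub_one_pow_dvd_shift_sub_shift_iff {J d e : ℕ} {a : R[X]} (ha : a.eval 1 ≠ 0) :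
    (X - 1) ^ J ∣ X ^ d * a - X ^ e * a ↔ d ≡ e [MOD p ^ Nat.clog p J] := by
  wlog hde : e ≤ d generalizing d e
  · rw [dvd_sub_comm, this (le_of_not_ge hde), Nat.ModEq.comm]
  obtain ⟨c, rfl⟩ := Nat.exists_eq_add_of_le hde
  rw [show X ^ (e + c) * a - X ^ e * a = X ^ e * a * (X ^ c - 1) by ring,
    X_sub_one_pow_dvd_mul_iff (by simpa), X_sub_one_pow_dvd_X_pow_sub_one_iff p, Nat.ModEq.comm,
    Nat.modEq_iff_dvd' (Nat.le_add_right e c), Nat.add_sub_cancel_left]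

end PowersOfX

section ClosedPath

variable {R : Type*} [CommRing R]

/-- The orbits of `a` and `b` under multiplication by powers of `X` agree modulo `(X - 1) ^ J`. -/
def ShiftRel (J : ℕ) (a b : R[X]) : Prop :=
  ∃ d e : ℕ, (X - 1) ^ J ∣ X ^ d * a - X ^ e * b

theorem ShiftRel.symm {J : ℕ} {a b : R[X]} : ShiftRel J a b → ShiftRel J b a :=
  fun ⟨d, e, h⟩ => ⟨e, d, (dvd_sub_comm).1 h⟩

theorem ShiftRel.trans {J : ℕ} {a b c : R[X]} :
    ShiftRel J a b → ShiftRel J b c → ShiftRel J a c :=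
  fun ⟨d, e, q, h⟩ ⟨d', e', q', h'⟩ => ⟨d' + d, e + e', X ^ d' * q + X ^ e * q', by
    linear_combination X ^ d' * h + X ^ e * h'⟩

theorem ShiftRel.of_le {J K : ℕ} (hJK : J ≤ K) {a b : R[X]} :
    ShiftRel K a b → ShiftRel J a b :=
  fun ⟨d, e, h⟩ => ⟨d, e, (pow_dvd_pow _ hJK).trans h⟩

theorem shiftRel_of_dvd_sub {J d : ℕ} {a b : R[X]} (h : (X - 1) ^ J ∣ b - X ^ d * a) :
    ShiftRel J a b :=
  ⟨d, 0, by simpa using (dvd_sub_comm).1 h⟩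

/-- `b` is obtained from `a` by a step that changes a single letter of the word `codeword n a`. -/
def IsGrayStep (a b : R[X]) : Prop :=
  ∃ c : R, c ≠ 0 ∧ ∃ i : ℕ, b = a + C c * (X - 1) * X ^ i

theorem IsGrayStep.affine {a b : R[X]} (h : IsGrayStep a b) (d : ℕ) (v : R[X]) :
    IsGrayStep (X ^ d * a + v) (X ^ d * b + v) := by
  obtain ⟨c, hc, i, rfl⟩ := h
  exact ⟨c, hc, d + i, by ring⟩

theorem IsGrayStep.eval_one {a b : R[X]} (h : IsGrayStep a b) : b.eval 1 = a.eval 1 := by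
  obtain ⟨c, -, i, rfl⟩ := h
  simp

/-- The failure of the path `u 0, …, u N` to return to its starting point shifted by `X ^ b`. -/
noncomputable def closingDefect (u : ℕ → R[X]) (N b : ℕ) : R[X] := u N - X ^ b * u 0

/-- The affine map with linear part `X ^ b` that sends `u 0` to `u N`. -/
noncomputable def closingMap (u : ℕ → R[X]) (N b : ℕ) (a : R[X]) : R[X] :=
  X ^ b * a + closingDefect u N b

/-- The continuation of the path `u 0, …, u N` to all indices, each block of `N` steps being the
image of the preceding one under `closingMap u N b`. -/
noncomputable def unroll (u : ℕ → R[X]) (N b k : ℕ) : R[X] :=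
  (closingMap u N b)^[k / N] (u (k % N))

variable {u : ℕ → R[X]} {N b J : ℕ}

theorem closingMap_iterate_affine (q : ℕ) :
    ∃ v, ∀ a, (closingMap u N b)^[q] a = X ^ (b * q) * a + v := by
  induction q with
  | zero => exact ⟨0, by simp⟩
  | succ q ih =>
    obtain ⟨v, hv⟩ := ih
    refine ⟨X ^ b * v + closingDefect u N b, fun a => ?_⟩
    rw [iterate_succ_apply', hv, closingMap]
    ring

theorem X_sub_one_pow_succ_dvd_closingMap_iterate_sub (h : (X - 1) ^ J ∣ closingDefect u N b)
    (q : ℕ) (a : R[X]) :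
    (X - 1) ^ (J + 1) ∣
      (closingMap u N b)^[q] a - (X ^ (b * q) * a + C (q : R) * closingDefect u N b) := by
  induction q with
  | zero => simp
  | succ q ih =>
    have hsplit : (closingMap u N b)^[q + 1] a
          - (X ^ (b * (q + 1)) * a + C ((q + 1 : ℕ) : R) * closingDefect u N b)
        = X ^ b * ((closingMap u N b)^[q] a - (X ^ (b * q) * a + C (q : R) * closingDefect u N b))
          + (X ^ b - 1) * (C (q : R) * closingDefect u N b) := by
      rw [iterate_succ_apply', closingMap]
      push_cast
      rw [C_add, C_1]
      ring
    rw [hsplit]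
    exact (ih.mul_left _).add (X_sub_one_pow_dvd_X_pow_sub_one_mul (h.mul_left _) b)

theorem X_sub_one_pow_dvd_closingMap_iterate_sub (h : (X - 1) ^ J ∣ closingDefect u N b)
    (q : ℕ) (a : R[X]) : (X - 1) ^ J ∣ (closingMap u N b)^[q] a - X ^ (b * q) * a := by
  have := ((pow_dvd_pow _ J.le_succ).trans
    (X_sub_one_pow_succ_dvd_closingMap_iterate_sub h q a)).add (h.mul_left (C (q : R)))
  convert this using 1
  ring

theorem unroll_of_le (hN : 0 < N) {k : ℕ} (hk : k ≤ N) : unroll u N b k = u k := by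
  rcases hk.lt_or_eq with hk | rfl
  · simp [unroll, Nat.div_eq_of_lt hk, Nat.mod_eq_of_lt hk]
  · simp [unroll, Nat.div_self hN, closingMap, closingDefect]

theorem unroll_add_mul (hN : 0 < N) (k q : ℕ) :
    unroll u N b (k + q * N) = (closingMap u N b)^[q] (unroll u N b k) := by
  simp only [unroll, Nat.add_mul_div_right _ _ hN, Nat.add_mul_mod_self_right, add_comm (k / N),
    iterate_add_apply]

theorem isGrayStep_unroll (hN : 0 < N) (hu : ∀ k < N, IsGrayStep (u k) (u (k + 1))) (k : ℕ) :
    IsGrayStep (unroll u N b k) (unroll u N b (k + 1)) := by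
  obtain ⟨v, hv⟩ := closingMap_iterate_affine (u := u) (N := N) (b := b) (k / N)
  have hk : k % N < N := Nat.mod_lt k hN
  rw [← Nat.mod_add_div' k N, add_right_comm, unroll_add_mul hN, unroll_add_mul hN,
    unroll_of_le hN hk.le, unroll_of_le hN hk, hv, hv]
  exact (hu _ hk).affine _ _

theorem eval_one_unroll_eq (hN : 0 < N) (hu : ∀ k < N, IsGrayStep (u k) (u (k + 1))) (k : ℕ) :
    (unroll u N b k).eval 1 = (u 0).eval 1 := by
  induction k with
  | zero => rw [unroll_of_le hN (Nat.zero_le N)]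
  | succ k ih => rw [(isGrayStep_unroll hN hu k).eval_one, ih]

theorem shiftRel_unroll (h : (X - 1) ^ J ∣ closingDefect u N b) (k : ℕ) :
    ShiftRel J (u (k % N)) (unroll u N b k) :=
  shiftRel_of_dvd_sub (X_sub_one_pow_dvd_closingMap_iterate_sub h _ _)

/-- The path that follows `u` up to `u k` and the image of `u` under `a ↦ X ^ d * a + v` from
index `k + 1` on. -/
noncomputable def reroute (u : ℕ → R[X]) (k d : ℕ) (v : R[X]) (m : ℕ) : R[X] :=
  if m ≤ k then u m else X ^ d * u m + v

theorem reroute_of_le {k m : ℕ} (h : m ≤ k) (d : ℕ) (v : R[X]) : reroute u k d v m = u m :=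
  if_pos h

theorem reroute_of_lt {k m : ℕ} (h : k < m) (d : ℕ) (v : R[X]) :
    reroute u k d v m = X ^ d * u m + v :=
  if_neg h.not_ge

theorem shiftRel_reroute {k d : ℕ} {v : R[X]} (hv : (X - 1) ^ J ∣ v) (m : ℕ) :
    ShiftRel J (u m) (reroute u k d v m) := by
  rcases le_or_gt m k with h | h
  · exact shiftRel_of_dvd_sub (d := 0) (by simp [reroute_of_le h])
  · exact shiftRel_of_dvd_sub (d := d) (by simpa [reroute_of_lt h])

theorem isGrayStep_reroute {k d : ℕ} {v : R[X]} (hu : ∀ m < N, IsGrayStep (u m) (u (m + 1)))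
    (hstep : IsGrayStep (u k) (X ^ d * u (k + 1) + v)) {m : ℕ} (hm : m < N) :
    IsGrayStep (reroute u k d v m) (reroute u k d v (m + 1)) := by
  rcases lt_trichotomy m k with h | rfl | h
  · simpa only [reroute_of_le h.le, reroute_of_le (Nat.succ_le_of_lt h)] using hu m hm
  · simpa only [reroute_of_le le_rfl, reroute_of_lt (Nat.lt_succ_self m)] using hstep
  · simpa only [reroute_of_lt h, reroute_of_lt (h.trans (Nat.lt_succ_self m))]
      using (hu m hm).affine d v

theorem closingDefect_reroute {k : ℕ} (hk : k < N) (d : ℕ) (v : R[X]) :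
    closingDefect (reroute u k d v) N (d + b) = X ^ d * closingDefect u N b + v := by
  rw [closingDefect, closingDefect, reroute_of_lt hk, reroute_of_le (Nat.zero_le k)]
  ring

/-- The path `u` can be rerouted after its first step so that its closing defect changes by a
term of multiplicity exactly `J`. -/
def HasDetour (J N : ℕ) (u : ℕ → R[X]) : Prop :=
  ∃ k, 0 < k ∧ k < N ∧ ∃ (d : ℕ) (v : R[X]), emultiplicity (X - 1) v = J ∧
    IsGrayStep (u k) (X ^ d * u (k + 1) + v)

theorem hasDetour_unroll [IsDomain R] (h2 : (2 : R) ≠ 0) (hN : 0 < N) (h0 : u 0 = 2 - X)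
    (h1 : u 1 = 1) (hb : emultiplicity (X - 1) (closingDefect u N b) = J) {M : ℕ} (hM : N < M) :
    HasDetour (J + 1) M (unroll u N b) := by
  set Z := closingDefect u N b
  have hblock (m : ℕ) (hm : m ≤ N) : unroll u N b (m + N) = X ^ b * u m + Z := by
    simpa [unroll_of_le hN hm, closingMap] using unroll_add_mul (u := u) (b := b) hN m 1
  refine ⟨N, hN, hM, 1, -((X - 1) * Z), ?_, 2, h2, b, ?_⟩
  · have hX : emultiplicity (X - 1) (X - 1 : R[X]) = 1 := by
      simpa using emultiplicity_pow_self_of_prime (prime_X_sub_one (R := R)) 1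
    rw [emultiplicity_neg, emultiplicity_mul prime_X_sub_one, hX, hb, add_comm, Nat.cast_succ]
  · have hN0 := hblock 0 (Nat.zero_le N)
    have hN1 := hblock 1 hN
    rw [zero_add, h0] at hN0
    rw [add_comm 1 N, h1] at hN1
    rw [hN0, hN1, C_ofNat]
    ring

end ClosedPath

section Track

variable {p : ℕ}

/-- A closed path of `N` steps, each changing one letter, that visits every orbit of the
polynomials `a` with `a.eval 1 = 1` under multiplication by `X` modulo `(X - 1) ^ J` exactly once.
There are `p ^ (J - 1)` such polynomials modulo `(X - 1) ^ J` and each orbit has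
`p ^ Nat.clog p J` elements, so `inj` and `card` together express that all orbits are visited. -/
structure IsTrack (J N : ℕ) (u : ℕ → (ZMod p)[X]) : Prop where
  eval_one_zero : (u 0).eval 1 = 1
  step : ∀ k < N, IsGrayStep (u k) (u (k + 1))
  inj : ∀ k < N, ∀ l < N, ShiftRel J (u k) (u l) → k = l
  closed : ∃ b, (X - 1) ^ J ∣ closingDefect u N b
  card : N * p ^ (Nat.clog p J + 1) = p ^ J

/-- A track with prescribed first two points that can be rerouted after its first step: the
invariant of the induction on `J`. -/
structure IsFlexibleTrack (J N : ℕ) (u : ℕ → (ZMod p)[X]) : Prop extends IsTrack J N u where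
  zero : u 0 = 2 - X
  one : u 1 = 1
  detour : HasDetour J N u

variable {J N b : ℕ} {u : ℕ → (ZMod p)[X]}

theorem IsTrack.isTrack_reroute (hu : IsTrack J N u) {k d : ℕ} {v : (ZMod p)[X]} (hk : k < N)
    (hv : (X - 1) ^ J ∣ v) (hstep : IsGrayStep (u k) (X ^ d * u (k + 1) + v)) :
    IsTrack J N (reroute u k d v) where
  eval_one_zero := by rw [reroute_of_le (Nat.zero_le k), hu.eval_one_zero]
  step _ hm := isGrayStep_reroute hu.step hstep hm
  inj m hm l hl h :=
    hu.inj m hm l hl (((shiftRel_reroute hv m).trans h).trans (shiftRel_reroute hv l).symm)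
  closed := by
    obtain ⟨b, hb⟩ := hu.closed
    exact ⟨d + b, by rw [closingDefect_reroute hk]; exact (hb.mul_left _).add hv⟩
  card := hu.card

variable [Fact p.Prime]

theorem IsTrack.pos (hu : IsTrack J N u) : 0 < N := by
  have hp : p.Prime := Fact.out
  refine Nat.pos_of_ne_zero ?_
  rintro rfl
  exact pow_ne_zero J hp.ne_zero (by simpa using hu.card.symm)

theorem IsTrack.eval_one_unroll (hu : IsTrack J N u) (k : ℕ) :
    (unroll u N b k).eval 1 = 1 := by
  rw [eval_one_unroll_eq hu.pos hu.step, hu.eval_one_zero]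

theorem IsTrack.eval_one (hu : IsTrack J N u) {k : ℕ} (hk : k ≤ N) : (u k).eval 1 = 1 := by
  rw [← unroll_of_le (u := u) (b := 0) hu.pos hk, hu.eval_one_unroll]

/-- If the shift orbits modulo `(X - 1) ^ J` and `(X - 1) ^ (J + 1)` have the same size, then a
shift of `a` that fixes `a` modulo `(X - 1) ^ J` fixes it modulo `(X - 1) ^ (J + 1)` and cannot
compensate the term `c * Z`. -/
theorem eq_zero_of_dvd_shift_sub_shift_add {R : Type*} [CommRing R] [IsDomain R] [CharP R p]
    (hJ : Nat.clog p J = Nat.clog p (J + 1)) {a Z : R[X]} (ha : a.eval 1 ≠ 0)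
    (hZ : emultiplicity (X - 1) Z = J) {d e : ℕ} {c : R}
    (h : (X - 1) ^ (J + 1) ∣ X ^ d * a - X ^ e * a + C c * Z) : c = 0 := by
  obtain ⟨hdvd, hndvd⟩ := emultiplicity_eq_coe.1 hZ
  have hshift : (X - 1) ^ J ∣ X ^ d * a - X ^ e * a :=
    (dvd_add_left (hdvd.mul_left (C c))).1 ((pow_dvd_pow _ J.le_succ).trans h)
  rw [X_sub_one_pow_dvd_shift_sub_shift_iff p ha, hJ,
    ← X_sub_one_pow_dvd_shift_sub_shift_iff p ha] at hshift
  by_contra hc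
  exact hndvd ((X_sub_one_pow_dvd_mul_iff (by simpa)).1 ((dvd_add_right hshift).1 h))

theorem eq_of_shiftRel_closingMap_iterate {R : Type*} [CommRing R] [IsDomain R] [CharP R p]
    {u : ℕ → R[X]} (hJ : Nat.clog p J = Nat.clog p (J + 1))
    (hb : emultiplicity (X - 1) (closingDefect u N b) = J) {a : R[X]} (ha : a.eval 1 ≠ 0)
    {q r : ℕ} (hq : q < p) (hr : r < p)
    (h : ShiftRel (J + 1) ((closingMap u N b)^[q] a) ((closingMap u N b)^[r] a)) : q = r := by
  have hdvd := (emultiplicity_eq_coe.1 hb).1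
  obtain ⟨d, e, h⟩ := h
  have hqr : (X - 1) ^ (J + 1) ∣ X ^ (d + b * q) * a - X ^ (e + b * r) * a
      + C ((q : R) - r) * closingDefect u N b := by
    have hiter (s : ℕ) := X_sub_one_pow_succ_dvd_closingMap_iterate_sub hdvd s a
    have hshift (s c : ℕ) :=
      (X_sub_one_pow_dvd_X_pow_sub_one_mul hdvd s).mul_left (C (c : R))
    convert (((h.sub ((hiter q).mul_left (X ^ d))).add ((hiter r).mul_left (X ^ e))).sub
      (hshift d q)).add (hshift e r) using 1
    rw [C_sub]
    ring
  have hcast : (q : R) = r := sub_eq_zero.1 (eq_zero_of_dvd_shift_sub_shift_add hJ ha hb hqr)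
  exact ((CharP.natCast_eq_natCast R p).1 hcast).eq_of_lt_of_lt hq hr

theorem IsTrack.isTrack_unroll (hu : IsTrack J N u) (hJ : Nat.clog p J = Nat.clog p (J + 1))
    (hb : emultiplicity (X - 1) (closingDefect u N b) = J) :
    IsTrack (J + 1) (p * N) (unroll u N b) where
  eval_one_zero := hu.eval_one_unroll 0
  step k _ := isGrayStep_unroll hu.pos hu.step k
  inj k hk l hl h := by
    have hdvd := (emultiplicity_eq_coe.1 hb).1
    have hmod : k % N = l % N :=
      hu.inj _ (Nat.mod_lt k hu.pos) _ (Nat.mod_lt l hu.pos)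
        (((shiftRel_unroll hdvd k).trans (h.of_le J.le_succ)).trans (shiftRel_unroll hdvd l).symm)
    have hone : (u (l % N)).eval 1 ≠ 0 := by
      simp [hu.eval_one (Nat.mod_lt l hu.pos).le]
    rw [unroll, unroll, hmod] at h
    have hdiv : k / N = l / N := eq_of_shiftRel_closingMap_iterate hJ hb hone
      ((Nat.div_lt_iff_lt_mul hu.pos).2 hk) ((Nat.div_lt_iff_lt_mul hu.pos).2 hl) h
    rw [← Nat.div_add_mod k N, ← Nat.div_add_mod l N, hdiv, hmod]
  closed := by
    refine ⟨b * p, ?_⟩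
    have hblock := unroll_add_mul (u := u) (b := b) hu.pos 0 p
    rw [zero_add] at hblock
    rw [closingDefect, hblock]
    simpa using X_sub_one_pow_succ_dvd_closingMap_iterate_sub (emultiplicity_eq_coe.1 hb).1 p
      (unroll u N b 0)
  card := by rw [← hJ, mul_assoc, hu.card, pow_succ']

theorem IsTrack.isFlexibleTrack_unroll (hu : IsTrack J N u) (h0 : u 0 = 2 - X) (h1 : u 1 = 1)
    (hp2 : p ≠ 2) (hJ : Nat.clog p J = Nat.clog p (J + 1))
    (hb : emultiplicity (X - 1) (closingDefect u N b) = J) :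
    IsFlexibleTrack (J + 1) (p * N) (unroll u N b) where
  toIsTrack := hu.isTrack_unroll hJ hb
  zero := by rw [unroll_of_le hu.pos N.zero_le, h0]
  one := by rw [unroll_of_le hu.pos hu.pos, h1]
  detour := hasDetour_unroll (Ring.two_ne_zero (by rwa [ZMod.ringChar_zmod_n])) hu.pos h0 h1 hb
    (lt_mul_of_one_lt_left hu.pos (Fact.out : p.Prime).one_lt)

/-- `X ^ (p ^ s * r)` is `1 + r * (X - 1) ^ p ^ s` modulo `(X - 1) ^ (p ^ s + 1)`, so
extra shifts absorb any closing defect. -/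
theorem exists_X_sub_one_pow_succ_dvd_closingDefect {s : ℕ} (h0 : (u 0).eval 1 ≠ 0)
    (h : (X - 1) ^ p ^ s ∣ closingDefect u N b) :
    ∃ d, (X - 1) ^ (p ^ s + 1) ∣ closingDefect u N d := by
  have hp : p.Prime := Fact.out
  obtain ⟨w, hw⟩ := h
  set y : (ZMod p)[X] := (X - 1) ^ p ^ s with hy
  obtain ⟨r, hr⟩ : ∃ r : ℕ, (r : ZMod p) = w.eval 1 / (u 0).eval 1 :=
    ZMod.natCast_zmod_surjective _
  obtain ⟨k, hk⟩ : y ^ 2 ∣ X ^ (p ^ s * r) - y * (r : (ZMod p)[X]) - 1 := by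
    have hX : (X ^ p ^ s : (ZMod p)[X]) = 1 + y := by
      rw [hy, ← X_pow_prime_pow_sub_one p, add_sub_cancel]
    simpa [pow_mul, hX] using sq_dvd_add_pow_sub_sub y 1 r
  have hdefect : closingDefect u N (b + p ^ s * r)
      = y * (w - (r : (ZMod p)[X]) * X ^ b * u 0) - y ^ 2 * (X ^ b * u 0 * k) := by
    rw [closingDefect] at hw ⊢
    linear_combination hw - X ^ b * u 0 * hk
  refine ⟨b + p ^ s * r, hdefect ▸ dvd_sub ?_ (Dvd.dvd.mul_right ?_ _)⟩
  · rw [pow_succ]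
    refine mul_dvd_mul_left _ (X_sub_one_dvd_iff.2 ?_)
    simp [hr, div_mul_cancel₀ _ h0]
  · rw [hy, ← pow_mul]
    have := Nat.pow_pos (n := s) hp.pos
    exact pow_dvd_pow _ (by omega)

theorem clog_pow_add_one {m : ℕ} (hm : 1 < m) (s : ℕ) : Nat.clog m (m ^ s + 1) = s + 1 := by
  refine le_antisymm (Nat.clog_le_of_le_pow ?_) ((Nat.lt_clog_iff_pow_lt hm).2 (Nat.lt_succ_self _))
  exact Nat.pow_lt_pow_right hm (Nat.lt_succ_self s)

theorem IsTrack.succ_of_eq_pow {s : ℕ} (hu : IsTrack (p ^ s) N u) : IsTrack (p ^ s + 1) N u where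
  eval_one_zero := hu.eval_one_zero
  step := hu.step
  inj k hk l hl h := hu.inj k hk l hl (h.of_le (Nat.le_succ _))
  closed := by
    obtain ⟨b, hb⟩ := hu.closed
    exact exists_X_sub_one_pow_succ_dvd_closingDefect (by simp [hu.eval_one_zero]) hb
  card := by
    have hp : p.Prime := Fact.out
    rw [clog_pow_add_one hp.one_lt, pow_succ p (s + 1), pow_succ p (p ^ s), ← hu.card,
      Nat.clog_pow p s hp.one_lt, mul_assoc]

theorem hasDetour_pow_add_one {R : Type*} [CommRing R] [IsDomain R] [CharP R p] {u : ℕ → R[X]}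
    (hN : 1 < N) (hu : IsGrayStep (u 1) (u 2)) (s : ℕ) : HasDetour (p ^ s + 1) N u := by
  obtain ⟨c, hc, i, h⟩ := hu
  refine ⟨1, one_pos, hN, 0, (X - 1) ^ (p ^ s + 1) * (C c * X ^ i),
    emultiplicity_X_sub_one_pow_mul (by simpa), c, hc, i + p ^ s, ?_⟩
  have hX : (X ^ p ^ s : R[X]) = 1 + (X - 1) ^ p ^ s := by
    rw [← X_pow_prime_pow_sub_one p, add_sub_cancel]
  rw [h, pow_add X i, hX]
  ring

theorem IsFlexibleTrack.succ_of_eq_pow {s : ℕ} (hu : IsFlexibleTrack (p ^ s) N u) :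
    IsFlexibleTrack (p ^ s + 1) N u where
  toIsTrack := hu.toIsTrack.succ_of_eq_pow
  zero := hu.zero
  one := hu.one
  detour := by
    obtain ⟨k, hk, hkN, -⟩ := hu.detour
    have hN : 1 < N := by omega
    exact hasDetour_pow_add_one hN (hu.step 1 hN) s

theorem IsFlexibleTrack.exists_emultiplicity_closingDefect_eq (hu : IsFlexibleTrack J N u) :
    ∃ (w : ℕ → (ZMod p)[X]) (b : ℕ), IsTrack J N w ∧ w 0 = 2 - X ∧ w 1 = 1 ∧
      emultiplicity (X - 1) (closingDefect w N b) = J := by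
  obtain ⟨b, hb⟩ := hu.closed
  rcases (le_emultiplicity_of_pow_dvd hb).eq_or_lt with hJ | hJ
  · exact ⟨u, b, hu.toIsTrack, hu.zero, hu.one, hJ.symm⟩
  obtain ⟨k, hk, hkN, d, v, hv, hstep⟩ := hu.detour
  refine ⟨reroute u k d v, d + b, hu.isTrack_reroute hkN (emultiplicity_eq_coe.1 hv).1 hstep,
    by rw [reroute_of_le k.zero_le, hu.zero], by rw [reroute_of_le hk, hu.one], ?_⟩
  have hlt : emultiplicity (X - 1) v < emultiplicity (X - 1) (X ^ d * closingDefect u N b) :=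
    hv ▸ hJ.trans_le (emultiplicity_le_emultiplicity_of_dvd_right (dvd_mul_left _ _))
  rw [closingDefect_reroute hkN, emultiplicity_add_of_gt hlt, hv]

theorem IsFlexibleTrack.exists_succ (hp2 : p ≠ 2) (hu : IsFlexibleTrack J N u) :
    ∃ (M : ℕ) (w : ℕ → (ZMod p)[X]), IsFlexibleTrack (J + 1) M w := by
  by_cases hJ : p ^ Nat.clog p J = J
  · rw [← hJ] at hu ⊢
    exact ⟨N, u, hu.succ_of_eq_pow⟩
  · obtain ⟨w, b, hw, h0, h1, hb⟩ := hu.exists_emultiplicity_closingDefect_eq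
    have hclog := (Nat.clog_eq_clog_succ_iff (Fact.out : p.Prime).one_lt).2 hJ
    exact ⟨p * N, unroll w N b, hw.isFlexibleTrack_unroll h0 h1 hp2 hclog hb⟩

theorem exists_isFlexibleTrack_three (hp2 : p ≠ 2) :
    ∃ (N : ℕ) (u : ℕ → (ZMod p)[X]), IsFlexibleTrack 3 N u := by
  have hp : p.Prime := Fact.out
  have hp3 : 3 ≤ p := by have := hp.two_le; omega
  have hclog2 : Nat.clog p 2 = 1 := Nat.clog_eq_one le_rfl hp.two_le
  have hclog3 : Nat.clog p 3 = 1 := Nat.clog_eq_one (by norm_num) hp3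
  set u : ℕ → (ZMod p)[X] := fun k => if k = 0 then 2 - X else 1
  have hdefect : closingDefect u 1 1 = (X - 1) ^ 2 := by
    simp only [u, closingDefect, one_ne_zero, if_true, if_false]
    ring
  have hu : IsTrack 2 1 u :=
    { eval_one_zero := by norm_num [u]
      step k hk := by
        obtain rfl : k = 0 := by omega
        refine ⟨1, one_ne_zero, 0, ?_⟩
        simp only [u, zero_add, one_ne_zero, if_true, if_false, C_1]
        ring
      inj k hk l hl _ := by omega
      closed := ⟨1, hdefect ▸ dvd_rfl⟩
      card := by rw [hclog2, one_mul] }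
  refine ⟨p * 1, unroll u 1 1, hu.isFlexibleTrack_unroll rfl rfl hp2 (by rw [hclog2, hclog3]) ?_⟩
  rw [hdefect]
  exact emultiplicity_pow_self_of_prime prime_X_sub_one 2

theorem exists_isFlexibleTrack (hp2 : p ≠ 2) (hJ : 3 ≤ J) :
    ∃ (N : ℕ) (u : ℕ → (ZMod p)[X]), IsFlexibleTrack J N u := by
  induction J, hJ using Nat.le_induction with
  | base => exact exists_isFlexibleTrack_three hp2
  | succ J _ ih =>
    obtain ⟨N, u, hu⟩ := ih
    exact hu.exists_succ hp2

/-- Replacing the first step `2 - X → 1` by `2 - X → X` increases the closing shift by one. -/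
theorem exists_isTrack_not_dvd (hp2 : p ≠ 2) (hJ : 3 ≤ J) :
    ∃ (N b : ℕ) (u : ℕ → (ZMod p)[X]),
      IsTrack J N u ∧ ¬ p ∣ b ∧ (X - 1) ^ J ∣ closingDefect u N b := by
  have hp : p.Prime := Fact.out
  obtain ⟨N, u, hu⟩ := exists_isFlexibleTrack (p := p) hp2 hJ
  obtain ⟨b, hb⟩ := hu.closed
  by_cases hpb : p ∣ b
  · have h2 : (2 : ZMod p) ≠ 0 := Ring.two_ne_zero (by rwa [ZMod.ringChar_zmod_n])
    have hstep : IsGrayStep (u 0) (X ^ 1 * u (0 + 1) + 0) := by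
      refine ⟨2, h2, 0, ?_⟩
      rw [hu.zero, zero_add, hu.one, C_ofNat]
      ring
    refine ⟨N, 1 + b, reroute u 0 1 0, hu.isTrack_reroute hu.pos (dvd_zero _) hstep, ?_, ?_⟩
    · exact fun h => hp.one_lt.ne' (Nat.dvd_one.1 ((Nat.dvd_add_left hpb).1 h))
    · rw [closingDefect_reroute hu.pos, add_zero]
      exact hb.mul_left _
  · exact ⟨N, b, u, hu.toIsTrack, hpb, hb⟩

theorem IsTrack.card_eq (hu : IsTrack (J + 1) N u) : N * p ^ Nat.clog p (J + 1) = p ^ J := by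
  have hcard := hu.card
  rw [pow_succ, pow_succ, ← mul_assoc] at hcard
  exact Nat.eq_of_mul_eq_mul_right (Fact.out : p.Prime).pos hcard

theorem dvd_unroll_add_mul_sub {R : Type*} [CommRing R] {u : ℕ → R[X]} (hN : 0 < N)
    (h : (X - 1) ^ J ∣ closingDefect u N b) (k q : ℕ) :
    (X - 1) ^ J ∣ unroll u N b (k + q * N) - X ^ (b * q) * unroll u N b k := by
  rw [unroll_add_mul hN]
  exact X_sub_one_pow_dvd_closingMap_iterate_sub h q _

theorem dvd_unroll_add_mul_sub_of_modEq {R : Type*} [CommRing R] [IsDomain R] [CharP R p]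
    {u : ℕ → R[X]} (hN : 0 < N) (h : (X - 1) ^ J ∣ closingDefect u N b) {k q i : ℕ}
    (hone : (unroll u N b k).eval 1 ≠ 0) (hq : b * q ≡ i [MOD p ^ Nat.clog p J]) :
    (X - 1) ^ J ∣ unroll u N b (k + q * N) - X ^ i * unroll u N b k :=
  (dvd_sub_comm).1 <| by
    simpa using ((dvd_sub_comm).1 (dvd_unroll_add_mul_sub hN h k q)).sub
      ((X_sub_one_pow_dvd_shift_sub_shift_iff p hone).2 hq)

theorem IsTrack.unroll_injOn (hu : IsTrack J N u) (hpb : ¬ p ∣ b)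
    (h : (X - 1) ^ J ∣ closingDefect u N b) {k l : ℕ} (hk : k < N * p ^ Nat.clog p J)
    (hl : l < N * p ^ Nat.clog p J) (hkl : (X - 1) ^ J ∣ unroll u N b k - unroll u N b l) :
    k = l := by
  have hp : p.Prime := Fact.out
  have hrel : ShiftRel J (unroll u N b k) (unroll u N b l) := ⟨0, 0, by simpa⟩
  have hmod : k % N = l % N :=
    hu.inj _ (Nat.mod_lt k hu.pos) _ (Nat.mod_lt l hu.pos)
      (((shiftRel_unroll h k).trans hrel).trans (shiftRel_unroll h l).symm)
  have hone : (u (l % N)).eval 1 ≠ 0 := by simp [hu.eval_one (Nat.mod_lt l hu.pos).le]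
  have hiter (q : ℕ) := X_sub_one_pow_dvd_closingMap_iterate_sub h q (u (l % N))
  have hshift : (X - 1) ^ J ∣ X ^ (b * (k / N)) * u (l % N) - X ^ (b * (l / N)) * u (l % N) := by
    rw [unroll, unroll, hmod] at hkl
    convert (hkl.sub (hiter (k / N))).add (hiter (l / N)) using 1
    ring
  have hcop : (p ^ Nat.clog p J).Coprime b :=
    ((Nat.Prime.coprime_iff_not_dvd hp).2 hpb).pow_left _
  have hdiv : k / N = l / N :=
    (((X_sub_one_pow_dvd_shift_sub_shift_iff p hone).1 hshift).cancel_left_of_coprime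
      hcop).eq_of_lt_of_lt (Nat.div_lt_of_lt_mul hk) (Nat.div_lt_of_lt_mul hl)
  rw [← Nat.div_add_mod k N, ← Nat.div_add_mod l N, hdiv, hmod]

end Track

section Codeword

variable {R : Type*} [CommRing R] {n : ℕ}

/-- The residue of a polynomial modulo `X ^ n - 1`, as an element of the group ring of `ℤ/n`: the
coefficients of the powers of `X` with exponents in the same class modulo `n` are added up. -/
noncomputable def cyclicFold (n : ℕ) : R[X] →ₐ[R] AddMonoidAlgebra R (ZMod n) :=
  aeval (AddMonoidAlgebra.single 1 1)

theorem cyclicFold_C_mul_X_pow (c : R) (i : ℕ) :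
    cyclicFold n (C c * X ^ i) = AddMonoidAlgebra.single (i : ZMod n) c := by
  simp [cyclicFold, AddMonoidAlgebra.single_pow]

theorem coeff_cyclicFold_X_mul (a : R[X]) (i : ZMod n) :
    (cyclicFold n (X * a)).coeff (i + 1) = (cyclicFold n a).coeff i := by
  simp [cyclicFold]

theorem coeff_cyclicFold_of_degree_lt {a : R[X]} (ha : a.degree < n) {i : ℕ} (hi : i < n) :
    (cyclicFold n a).coeff (i : ZMod n) = a.coeff i := by
  have hclass {j : ℕ} (hj : j < n) : (j : ZMod n) = i ↔ i = j := by
    rw [ZMod.natCast_eq_natCast_iff', Nat.mod_eq_of_lt hj, Nat.mod_eq_of_lt hi, eq_comm]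
  rw [degree_lt_iff_coeff_zero] at ha
  have hsum : a = ∑ j ∈ Finset.range n, C (a.coeff j) * X ^ j := by
    ext k
    simp only [finsetSum_coeff, coeff_C_mul_X_pow, Finset.sum_ite_eq, Finset.mem_range]
    split_ifs with hk
    · rfl
    · exact ha k (not_lt.1 hk)
  conv_lhs => rw [hsum]
  rw [map_sum]
  simp only [cyclicFold_C_mul_X_pow, AddMonoidAlgebra.coeff_sum, Finsupp.finsetSum_apply,
    AddMonoidAlgebra.coeff_single, Finsupp.single_apply]
  rw [Finset.sum_congr rfl fun j hj => if_congr (hclass (Finset.mem_range.1 hj)) rfl rfl]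
  simp [hi]

theorem cyclicFold_eq_zero_iff [NeZero n] {a : R[X]} : cyclicFold n a = 0 ↔ X ^ n - 1 ∣ a := by
  have hker {a : R[X]} (h : X ^ n - 1 ∣ a) : cyclicFold n a = 0 := by
    obtain ⟨q, rfl⟩ := h
    rw [map_mul, map_sub, ← one_mul (X ^ n), ← C_1, cyclicFold_C_mul_X_pow]
    simp [← AddMonoidAlgebra.one_def]
  refine ⟨fun h => ?_, hker⟩
  nontriviality R
  have hmonic : (X ^ n - 1 : R[X]).Monic := monic_X_pow_sub_C 1 (NeZero.ne n)
  have hdeg : (a %ₘ (X ^ n - 1)).degree < n :=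
    (degree_modByMonic_lt a hmonic).trans_eq (degree_X_pow_sub_C (NeZero.pos n) 1)
  have hrem : cyclicFold n (a %ₘ (X ^ n - 1)) = 0 := by
    rw [modByMonic_eq_sub_mul_div, map_sub, h, hker (dvd_mul_right _ _), sub_zero]
  rw [← modByMonic_eq_zero_iff_dvd hmonic]
  ext i
  rcases lt_or_ge i n with hi | hi
  · rw [← coeff_cyclicFold_of_degree_lt hdeg hi, hrem]
    simp
  · exact coeff_eq_zero_of_degree_lt (hdeg.trans_le (by exact_mod_cast hi))

/-- The word of length `n` coded by a polynomial `a` with `a.eval 1 = 1`: the coefficients of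
`(a - 1) / (X - 1)` modulo `X ^ n - 1`. The offset makes multiplication of `a` by `X` shift the
word cyclically and add `1` to its first letter. -/
noncomputable def codeword (n : ℕ) (a : R[X]) (i : Fin n) : R :=
  (cyclicFold n ((a - 1) /ₘ (X - C 1))).coeff (i : ZMod n)

theorem exists_eq_one_add_mul {a : R[X]} (ha : a.eval 1 = 1) : ∃ g, a = 1 + (X - 1) * g := by
  obtain ⟨g, hg⟩ := X_sub_one_dvd_iff.2 (show (a - 1).eval 1 = 0 by simp [ha])
  exact ⟨g, by linear_combination hg⟩

theorem codeword_one_add_mul (g : R[X]) (i : Fin n) :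
    codeword n (1 + (X - 1) * g) i = (cyclicFold n g).coeff (i : ZMod n) := by
  rw [codeword, add_sub_cancel_left, ← C_1, mul_divByMonic_cancel_left _ (monic_X_sub_C 1)]

theorem codeword_eq_iff [IsDomain R] [NeZero n] {a b : R[X]} (ha : a.eval 1 = 1)
    (hb : b.eval 1 = 1) :
    codeword n a = codeword n b ↔ (X - 1) * (X ^ n - 1) ∣ a - b := by
  obtain ⟨g, rfl⟩ := exists_eq_one_add_mul ha
  obtain ⟨f, rfl⟩ := exists_eq_one_add_mul hb
  rw [add_sub_add_left_eq_sub, ← mul_sub, mul_dvd_mul_iff_left prime_X_sub_one.ne_zero,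
    ← cyclicFold_eq_zero_iff, map_sub, sub_eq_zero]
  simp only [funext_iff, codeword_one_add_mul]
  refine ⟨fun h => ?_, fun h i => by rw [h]⟩
  ext i
  simpa using h ⟨i.val, i.val_lt⟩

theorem codeword_X_mul {a : R[X]} (ha : a.eval 1 = 1) {i : ℕ} (hi : i + 1 < n) :
    codeword n (X * a) ⟨i + 1, hi⟩ = codeword n a ⟨i, by omega⟩ := by
  obtain ⟨g, rfl⟩ := exists_eq_one_add_mul ha
  have hne : ((i + 1 : ℕ) : ZMod n) ≠ 0 := by
    rw [Ne, ZMod.natCast_eq_zero_iff]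
    exact Nat.not_dvd_of_pos_of_lt i.succ_pos hi
  rw [show X * (1 + (X - 1) * g) = 1 + (X - 1) * (X * g + 1) by ring, codeword_one_add_mul,
    codeword_one_add_mul, map_add, map_one, AddMonoidAlgebra.coeff_add, Finsupp.add_apply,
    AddMonoidAlgebra.one_def, AddMonoidAlgebra.coeff_single, Finsupp.single_eq_of_ne hne, add_zero,
    Nat.cast_succ, coeff_cyclicFold_X_mul]

theorem codeword_X_pow_mul {a : R[X]} (ha : a.eval 1 = 1) {i : ℕ} (hi : i < n) :
    codeword n (X ^ i * a) ⟨i, hi⟩ = codeword n a ⟨0, by omega⟩ := by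
  induction i with
  | zero => simp
  | succ i ih => rw [pow_succ', mul_assoc, codeword_X_mul (by simp [ha]), ih]

theorem IsGrayStep.existsUnique_codeword_ne [NeZero n] {a b : R[X]} (h : IsGrayStep a b)
    (ha : a.eval 1 = 1) : ∃! i, codeword n a i ≠ codeword n b i := by
  obtain ⟨c, hc, k, rfl⟩ := h
  obtain ⟨g, rfl⟩ := exists_eq_one_add_mul ha
  rw [show 1 + (X - 1) * g + C c * (X - 1) * X ^ k = 1 + (X - 1) * (g + C c * X ^ k) by ring]
  have hne (i : Fin n) : codeword n (1 + (X - 1) * g) i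
      ≠ codeword n (1 + (X - 1) * (g + C c * X ^ k)) i ↔ (i : ℕ) = k % n := by
    rw [codeword_one_add_mul, codeword_one_add_mul, map_add, cyclicFold_C_mul_X_pow]
    simp [Finsupp.single_apply, hc, ZMod.natCast_eq_natCast_iff', Nat.mod_eq_of_lt i.isLt, eq_comm]
  simp only [hne]
  exact ⟨⟨k % n, Nat.mod_lt k (NeZero.pos n)⟩, rfl, fun i hi => Fin.ext hi⟩

end Codeword

section Existence

variable {p : ℕ} [Fact p.Prime]

theorem codeword_prime_pow_eq_iff {R : Type*} [CommRing R] [IsDomain R] [CharP R p] {t : ℕ}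
    {a b : R[X]} (ha : a.eval 1 = 1) (hb : b.eval 1 = 1) :
    codeword (p ^ t) a = codeword (p ^ t) b ↔ (X - 1) ^ (p ^ t + 1) ∣ a - b := by
  rw [codeword_eq_iff ha hb, X_pow_prime_pow_sub_one p, pow_succ']

theorem IsTrack.isSingleTrackGrayCode {t N b : ℕ} {u : ℕ → (ZMod p)[X]}
    (hu : IsTrack (p ^ t + 1) N u) (hpb : ¬ p ∣ b)
    (h : (X - 1) ^ (p ^ t + 1) ∣ closingDefect u N b) :
    IsSingleTrackGrayCode p (p ^ t) (p ^ p ^ t)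
      fun j => codeword (p ^ t) (unroll u N b j.val) := by
  have hp : p.Prime := Fact.out
  have hone := hu.eval_one_unroll (b := b)
  have hcong {a a' : (ZMod p)[X]} (ha : a.eval 1 = 1) (ha' : a'.eval 1 = 1) :=
    codeword_prime_pow_eq_iff (t := t) ha ha'
  refine isSingleTrackGrayCode_of_periodic
    (F := fun k => codeword (p ^ t) (unroll u N b k)) (pow_pos hp.pos _) ?periodic ?injOn
    (fun k => (isGrayStep_unroll hu.pos hu.step k).existsUnique_codeword_ne (hone k)) ?track
  case periodic =>
    intro k
    have hperiod := dvd_unroll_add_mul_sub_of_modEq hu.pos h (k := k) (i := 0) (by simp [hone])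
      ((dvd_mul_left (p ^ Nat.clog p (p ^ t + 1)) b).modEq_zero_nat)
    rw [hcong (hone _) (hone _), ← hu.card_eq, mul_comm N]
    simpa using hperiod
  case injOn =>
    intro k hk l hl hkl
    rw [Set.mem_Iio, ← hu.card_eq] at hk hl
    exact hu.unroll_injOn hpb h hk hl ((hcong (hone k) (hone l)).1 hkl)
  case track =>
    have hcop : b.Coprime (p ^ Nat.clog p (p ^ t + 1)) :=
      (((Nat.Prime.coprime_iff_not_dvd hp).2 hpb).pow_left _).symm
    intro i
    obtain ⟨q, -, hq⟩ := Nat.exists_mul_mod_eq_of_coprime i hcop (pow_ne_zero _ hp.ne_zero)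
    refine ⟨q * N, fun k => ?_⟩
    have hshift := dvd_unroll_add_mul_sub_of_modEq hu.pos h (k := k) (by simp [hone]) hq
    have hword := (hcong (hone _) (by simp [hone])).2 hshift
    rw [hword]
    exact codeword_X_pow_mul (hone k) i.isLt

theorem exists_isSingleTrackGrayCode (hp2 : p ≠ 2) {t : ℕ} (ht : 1 ≤ t) :
    ∃ W : ZMod (p ^ p ^ t) → Fin (p ^ t) → ZMod p,
      IsSingleTrackGrayCode p (p ^ t) (p ^ p ^ t) W := by
  have hp : p.Prime := Fact.out
  have hJ : 3 ≤ p ^ t + 1 := Nat.succ_le_succ (hp.two_le.trans (Nat.le_self_pow (by omega) p))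
  obtain ⟨N, b, u, hu, hpb, hb⟩ := exists_isTrack_not_dvd hp2 hJ
  exact ⟨_, hu.isSingleTrackGrayCode hpb hb⟩

end Existence

theorem mainTheorem1 (p t : ℕ) (hp : p.Prime) (hodd : Odd p) (ht : 1 ≤ t) :
    (∃ W : ZMod (p ^ p ^ t) → Fin (p ^ t) → ZMod p,
      IsSingleTrackGrayCode p (p ^ t) (p ^ p ^ t) W) ∧
    (∀ W : ZMod (p ^ p ^ t) → Fin (p ^ t) → ZMod p,
      IsSingleTrackGrayCode p (p ^ t) (p ^ p ^ t) W →
        ∀ w : Fin (p ^ t) → ZMod p, ∃! j : ZMod (p ^ p ^ t), W j = w) ∧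
    (∀ (P : ℕ) (W : ZMod P → Fin (p ^ t) → ZMod p),
      IsSingleTrackGrayCode p (p ^ t) P W → P ≤ p ^ p ^ t) := by
  have : Fact p.Prime := ⟨hp⟩
  have hp2 : p ≠ 2 := by
    rintro rfl
    exact absurd hodd (by decide)
  exact ⟨exists_isSingleTrackGrayCode hp2 ht, fun _ hW => hW.existsUnique_eq,
    fun _ _ hW => hW.period_le⟩
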